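/- Let $\mathbb F$ be a field with algebraic closure $\overline{\mathbb F}$, and let $n\ge 0$ be an integer. A *pencil* is a matrix $G(s)=G_0+sG_1$ with $G_0,G_1\in\mathbb F^{n\times n}$; it is *regular* if $\det G(s)\neq 0$ in $\mathbb F[s]$. Its rank is its rank over the field of rational functions $\mathbb F(s)$. Two pencils $G(s),H(s)$ are *strictly equivalent* if $G(s)=Q\,H(s)\,R$ for some invertible $Q,R\in\mathbb F^{n\times n}$. For a regular pencil $G(s)=G_0+sG_1$ and $0\le k\le n$, let $D_k$ be the monic greatest common divisor of the minors of order $k$ of $G(s)$ ($D_0=1$), and let $\gamma_k=D_k/D_{k-1}$, $1\le k\le n$, be the invariant factors of $G(s)$. For $\lambda\in\overline{\mathbb F}$ the *partial multiplicity* $m_k(\lambda,G)$ is the multiplicity of $\lambda$ as a root of $\gamma_k$. The partial multiplicity $m_k(\infty,G)$ is the integer $q\ge 0$ such that the $k$-th invariant factor of the pencil $tG_0+G_1$ (in the indeterminate $t$) equals $c\,t^{q}\,t^{\deg\gamma_k}\gamma_k(1/t)$ for some nonzero $c\in\mathbb F$; equivalently, it is the multiplicity of $0$ as a root of that invariant factor.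 For $\lambda\in\overline{\mathbb F}\cup\{\infty\}$ let $$w_i(\lambda,G)=\#\{j\in\{1,\dots,n\}: m_j(\lambda,G)\ge i\},\quad 1\le i\le n,$$ be the partition conjugate to the partial multiplicities at $\lambda$, and let $\mu_g(\lambda,G)=\#\{j\in\{1,\dots,n\}: m_j(\lambda,G)>0\}$ be the geometric multiplicity of $\lambda$. Let $A(s),B(s)\in\mathbb F[s]^{n\times n}$ be regular pencils, and let $P(s)\in\mathbb F[s]^{n\times n}$ be a pencil with $\operatorname{rank}P(s)=r$ such that $A(s)+P(s)$ is strictly equivalent to $B(s)$. Then $$w_i(\lambda,A)-r\le w_i(\lambda,B)\le w_i(\lambda,A)+r,\qquad 1\le i\le n,\quad \lambda\in\overline{\mathbb F}\cup\{\infty\};$$ equivalently, $$w_i(\lambda,B)-r\le w_i(\lambda,A)\le w_i(\lambda,B)+r,\qquad 1\le i\le n,\quad \lambda\in\overline{\mathbb F}\cup\{\infty\}.$$ In particular, $$\mu_g(\lambda,A)-r\le \mu_g(\lambda,B)\le \mu_g(\lambda,A)+r,\qquad \lambda\in\overline{\mathbb F}\cup\{\infty\}.$$ -/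

import Mathlib

open Polynomial

/-- The monic greatest common divisor of the minors of order `k` of a polynomial matrix (it is `0`
if all these minors vanish). A minor of order `k` is obtained by choosing `k` rows and `k` columns,
listed increasingly. For `k = 0` the only minor is the empty determinant `1`. -/
noncomputable def detDivisor {F : Type*} [Field F] {m n : ℕ}
    (G : Matrix (Fin m) (Fin n) F[X]) (k : ℕ) : F[X] :=
  letI := Classical.decEq F
  letI : NormalizedGCDMonoid F[X] := UniqueFactorizationMonoid.toNormalizedGCDMonoid F[X]
  (Finset.univ : Finset ((Fin k ↪o Fin m) × (Fin k ↪o Fin n))).gcd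
    fun e => (G.submatrix e.1 e.2).det

/-- The `k`-th invariant factor `D_k / D_{k-1}` of a polynomial matrix, for `1 ≤ k ≤ rank`. The
division is exact. -/
noncomputable def invFactor {F : Type*} [Field F] {m n : ℕ}
    (G : Matrix (Fin m) (Fin n) F[X]) (k : ℕ) : F[X] :=
  detDivisor G k / detDivisor G (k - 1)

/-- The normal rank of a polynomial matrix: its rank over the field of rational functions. -/
noncomputable def normalRank {F : Type*} [Field F] {m n : ℕ}
    (G : Matrix (Fin m) (Fin n) F[X]) : ℕ :=
  (G.map (algebraMap F[X] (RatFunc F))).rank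

/-- A matrix pencil: a polynomial matrix all of whose entries have degree at most one. -/
def IsPencil {F : Type*} [Field F] {m n : ℕ} (G : Matrix (Fin m) (Fin n) F[X]) : Prop :=
  ∀ i j, (G i j).degree ≤ 1

/-- A regular pencil: a square pencil whose determinant is not the zero polynomial. -/
def IsRegularPencil {F : Type*} [Field F] {n : ℕ} (G : Matrix (Fin n) (Fin n) F[X]) : Prop :=
  IsPencil G ∧ G.det ≠ 0

/-- Strict equivalence: `G = Q H R` with `Q`, `R` invertible matrices of constants. -/
def StrictlyEquivalent {F : Type*} [Field F] {m n : ℕ}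
    (G H : Matrix (Fin m) (Fin n) F[X]) : Prop :=
  ∃ (Q : GL (Fin m) F) (R : GL (Fin n) F),
    G = (Q : Matrix (Fin m) (Fin m) F).map C * H * (R : Matrix (Fin n) (Fin n) F).map C

/-- For a pencil `G = G₀ + s G₁`, the reversed pencil `t G₀ + G₁`. -/
noncomputable def revPencil {F : Type*} [Field F] {m n : ℕ}
    (G : Matrix (Fin m) (Fin n) F[X]) : Matrix (Fin m) (Fin n) F[X] :=
  Matrix.of fun i j => X * C ((G i j).coeff 0) + C ((G i j).coeff 1)

/-- The `i`-th partial multiplicity `m_i(μ, G)` (for `1 ≤ i ≤ n`) of a regular `n × n` pencil at a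
point `μ` of the projective line over the algebraic closure of `F`.
At a finite `μ` it is the exponent of `s - μ` in the `i`-th invariant factor of `G`. At `∞` it is
the exponent `q` for which the `i`-th invariant factor of the reversed pencil is, up to a nonzero
constant, `t ^ q * (t ^ deg γ * γ (1 / t))`, where `γ` is the `i`-th invariant factor of `G`; as
the second factor does not vanish at `t = 0`, `q` is the order of vanishing at `t = 0`
(see `partialMult_infty_eq`). -/
noncomputable def partialMult {F : Type*} [Field F] {n : ℕ}
    (G : Matrix (Fin n) (Fin n) F[X]) : OnePoint (AlgebraicClosure F) → ℕ → ℕ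
  | none, i => (invFactor (revPencil G) i).rootMultiplicity 0
  | some μ, i =>
      ((invFactor G i).map (algebraMap F (AlgebraicClosure F))).rootMultiplicity μ

/-- The value at `∞` is the exponent `q` described above. Here `Polynomial.reverse γ` is
`t ^ deg γ * γ (1 / t)`. -/
theorem partialMult_infty_eq {F : Type*} [Field F] {n : ℕ} (G : Matrix (Fin n) (Fin n) F[X])
    (i q : ℕ) (k : F) (hk : k ≠ 0) (hγ : invFactor G i ≠ 0)
    (h : invFactor (revPencil G) i = C k * (X ^ q * (invFactor G i).reverse)) :
    partialMult G OnePoint.infty i = q := by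
  have h0 : (invFactor G i).reverse.coeff 0 ≠ 0 := by
    rw [coeff_zero_reverse]
    exact leadingCoeff_ne_zero.mpr hγ
  have hr : (invFactor G i).reverse ≠ 0 := by
    intro h1
    rw [h1] at h0
    simp at h0
  change (invFactor (revPencil G) i).rootMultiplicity 0 = q
  have hne : X ^ q * (invFactor G i).reverse ≠ 0 := mul_ne_zero (pow_ne_zero _ X_ne_zero) hr
  have h1 : (C k).rootMultiplicity 0 = 0 := rootMultiplicity_C k 0
  have h2 : ((invFactor G i).reverse).rootMultiplicity 0 = 0 := by
    apply rootMultiplicity_eq_zero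
    rwa [IsRoot.def, ← coeff_zero_eq_eval_zero]
  have h3 : (X ^ q : F[X]).rootMultiplicity 0 = q := by
    simpa using rootMultiplicity_X_sub_C_pow (0 : F) q
  rw [h, rootMultiplicity_mul (mul_ne_zero (C_ne_zero.mpr hk) hne), rootMultiplicity_mul hne,
    h1, h2, h3]
  simp

/-- The conjugate partition of the partial multiplicities:
`w_i(μ, G) = #{j ∈ {1, …, n} : m_j(μ, G) ≥ i}`. -/
noncomputable def conjMult {F : Type*} [Field F] {n : ℕ}
    (G : Matrix (Fin n) (Fin n) F[X]) (μ : OnePoint (AlgebraicClosure F)) (i : ℕ) : ℕ :=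
  ((Finset.Icc 1 n).filter fun j => i ≤ partialMult G μ j).card

/-- The geometric multiplicity: the number of nonzero partial multiplicities. -/
noncomputable def geomMult {F : Type*} [Field F] {n : ℕ}
    (G : Matrix (Fin n) (Fin n) F[X]) (μ : OnePoint (AlgebraicClosure F)) : ℕ :=
  ((Finset.Icc 1 n).filter fun j => 0 < partialMult G μ j).card

/-! Fix a point `μ` and let `L` be the module of polynomial vectors `x` with `(X - μ) ^ i ∣ G x`.
The values at `μ` of the vectors in `L` form a space, `rootSpace`, whose dimension is `w_i(μ, G)`.
Indeed this dimension is invariant under unimodular equivalence, and for a diagonal matrix it counts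
the entries divisible by `(X - μ) ^ i`; determinantal divisors identify these orders with the
partial multiplicities (`card_filter_le_rootMultiplicity_eq_finrank`).

On `L ∩ ker P` the matrices `G` and `G + P` agree, and `L` is generated modulo this intersection by
at most `rank P` vectors. Hence the dimension drops by at most `rank P`
(`finrank_rootSpace_le_add`); adding `-P` back gives the other inequality. The point `∞` is the
point `0` of the reversed pencil, whose perturbation has rank at most `r` as well. -/

/-! ### Minors under equivalence and of diagonal matrices -/

/-- Divisibility of all minors of order `k`, for arbitrary choices of rows and columns. -/
def DvdMinors {R ι κ : Type*} [CommRing R] (q : R) (k : ℕ) (G : Matrix ι κ R) : Prop :=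
  ∀ (e₁ : Fin k → ι) (e₂ : Fin k → κ), q ∣ (G.submatrix e₁ e₂).det

/-- A repeated index makes the minor vanish, and sorting the indices changes only its sign. -/
theorem dvdMinors_iff_orderEmbedding {R : Type*} [CommRing R] {m n k : ℕ} {q : R}
    {G : Matrix (Fin m) (Fin n) R} :
    DvdMinors q k G ↔
      ∀ (e₁ : Fin k ↪o Fin m) (e₂ : Fin k ↪o Fin n), q ∣ (G.submatrix e₁ e₂).det := by
  refine ⟨fun h e₁ e₂ => h e₁ e₂, fun h e₁ e₂ => ?_⟩
  by_cases h₁ : Function.Injective e₁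
  swap
  · simp only [Function.Injective, not_forall] at h₁
    obtain ⟨a, b, hab, hne⟩ := h₁
    rw [Matrix.det_zero_of_row_eq hne (by ext j; simp [hab])]
    exact dvd_zero _
  by_cases h₂ : Function.Injective e₂
  swap
  · simp only [Function.Injective, not_forall] at h₂
    obtain ⟨a, b, hab, hne⟩ := h₂
    rw [Matrix.det_zero_of_column_eq hne (by intro j; simp [hab])]
    exact dvd_zero _
  have s₁ : StrictMono (e₁ ∘ Tuple.sort e₁) :=
    (Tuple.monotone_sort e₁).strictMono_of_injective (h₁.comp (Tuple.sort e₁).injective)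
  have s₂ : StrictMono (e₂ ∘ Tuple.sort e₂) :=
    (Tuple.monotone_sort e₂).strictMono_of_injective (h₂.comp (Tuple.sort e₂).injective)
  have h := h (OrderEmbedding.ofStrictMono _ s₁) (OrderEmbedding.ofStrictMono _ s₂)
  have e : G.submatrix (OrderEmbedding.ofStrictMono _ s₁) (OrderEmbedding.ofStrictMono _ s₂)
      = ((G.submatrix e₁ e₂).submatrix (Tuple.sort e₁) id).submatrix id (Tuple.sort e₂) := by
    ext i j
    simp
  rw [e, Matrix.det_permute', Matrix.det_permute] at h
  have u : ∀ σ : Equiv.Perm (Fin k), IsUnit (((Equiv.Perm.sign σ : ℤˣ) : ℤ) : R) := fun σ =>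
    (Units.isUnit _).map (Int.castRingHom R)
  rwa [(u _).dvd_mul_left, (u _).dvd_mul_left] at h

/-- Multilinear expansion along the rows of the product. Summing over all maps `f`, not only
increasing ones, is enough for divisibility and avoids the full Cauchy–Binet formula. -/
theorem Matrix.det_mul_eq_sum_minors {R ι κ : Type*} [CommRing R] [Fintype ι] [DecidableEq ι]
    [Fintype κ] [DecidableEq κ] (M : Matrix ι κ R) (N : Matrix κ ι R) :
    (M * N).det = ∑ f : ι → κ, (∏ i, M i (f i)) * (N.submatrix f id).det := by
  have e : M * N = fun i => ∑ l, M i l • N l := by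
    ext i j
    simp [Matrix.mul_apply, Finset.sum_apply]
  have := (Matrix.detRowAlternating (R := R) (n := ι)).toMultilinearMap.map_sum
    (fun i l => M i l • N l)
  rw [e]
  refine this.trans (Finset.sum_congr rfl fun f _ => ?_)
  exact (Matrix.detRowAlternating (R := R) (n := ι)).toMultilinearMap.map_smul_univ
    (fun i => M i (f i)) (fun i => N (f i))

theorem DvdMinors.mul_left {R ι κ l : Type*} [CommRing R] [Fintype ι] [DecidableEq ι]
    {q : R} {k : ℕ} {G : Matrix ι κ R} (h : DvdMinors q k G) (U : Matrix l ι R) :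
    DvdMinors q k (U * G) := by
  intro e₁ e₂
  have e : (U * G).submatrix e₁ e₂ = U.submatrix e₁ id * G.submatrix id e₂ := by
    ext i j
    simp [Matrix.mul_apply]
  rw [e, Matrix.det_mul_eq_sum_minors]
  exact Finset.dvd_sum fun f _ => (h f e₂).mul_left _

theorem DvdMinors.transpose {R ι κ : Type*} [CommRing R]
    {q : R} {k : ℕ} {G : Matrix ι κ R} (h : DvdMinors q k G) : DvdMinors q k G.transpose := by
  intro e₁ e₂
  have := h e₂ e₁
  rwa [← Matrix.det_transpose] at this

theorem DvdMinors.mul_right {R ι κ l : Type*} [CommRing R] [Fintype κ] [DecidableEq κ]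
    {q : R} {k : ℕ} {G : Matrix ι κ R} (h : DvdMinors q k G) (V : Matrix κ l R) :
    DvdMinors q k (G * V) := by
  have := (h.transpose.mul_left V.transpose).transpose
  rwa [← Matrix.transpose_mul, Matrix.transpose_transpose] at this

theorem dvdMinors_mul_mul_iff {R ι : Type*} [CommRing R] [Fintype ι] [DecidableEq ι]
    {q : R} {k : ℕ} {G U V : Matrix ι ι R} (hU : IsUnit U.det) (hV : IsUnit V.det) :
    DvdMinors q k (U * G * V) ↔ DvdMinors q k G := by
  refine ⟨fun h => ?_, fun h => (h.mul_left U).mul_right V⟩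
  have := (h.mul_left U⁻¹).mul_right V⁻¹
  rwa [Matrix.mul_assoc U, Matrix.nonsing_inv_mul_cancel_left _ _ hU,
    Matrix.mul_nonsing_inv_cancel_right _ _ hV] at this

theorem dvdMinors_diagonal_iff {R : Type*} [CommRing R] {n k : ℕ} {q : R} {d : Fin n → R} :
    DvdMinors q k (Matrix.diagonal d) ↔ ∀ e : Fin k ↪o Fin n, q ∣ ∏ i, d (e i) := by
  rw [dvdMinors_iff_orderEmbedding]
  constructor
  · intro h e
    have := h e e
    rwa [Matrix.submatrix_diagonal _ _ e.injective, Matrix.det_diagonal] at this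
  · intro h e₁ e₂
    -- Pulling `d (e₁ i)` out of row `i` also covers the non-principal minors.
    have e : (Matrix.diagonal d).submatrix e₁ e₂ =
        Matrix.of fun i j => d (e₁ i) * ((1 : Matrix (Fin n) (Fin n) R).submatrix e₁ e₂) i j := by
      ext i j
      simp [Matrix.diagonal_apply, Matrix.one_apply]
    rw [e, Matrix.det_mul_column]
    exact (h e₁).mul_right _

theorem OrderEmbedding.castLE_le_apply {k n : ℕ} (e : Fin k ↪o Fin n) (h : k ≤ n) (i : Fin k) :
    Fin.castLE h i ≤ e i := by
  obtain ⟨i, hi⟩ := i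
  rw [Fin.le_def]
  change i ≤ (e ⟨i, hi⟩ : ℕ)
  induction i with
  | zero => exact Nat.zero_le _
  | succ i ih =>
    have h1 := ih (by omega)
    have h2 : e ⟨i, by omega⟩ < e ⟨i + 1, hi⟩ := e.strictMono (by simp [Fin.lt_def])
    rw [Fin.lt_def] at h2
    omega

/-- The `i`-th index of an increasing choice is at least `i`, so by monotonicity the first `k`
entries have the least total order. -/
theorem dvdMinors_diagonal_iff_of_chain {R : Type*} [CommRing R] {n k : ℕ} (hk : k ≤ n)
    (v : R → ℕ) {d : Fin n → R} {p : R} {a : ℕ}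
    (hp : ∀ e : Fin k ↪o Fin n, p ^ a ∣ ∏ i, d (e i) ↔ a ≤ ∑ i, v (d (e i)))
    (hd : Monotone fun i => v (d i)) :
    DvdMinors (p ^ a) k (Matrix.diagonal d) ↔ p ^ a ∣ ∏ i, d (Fin.castLE hk i) := by
  rw [dvdMinors_diagonal_iff]
  refine ⟨fun h => h (Fin.castLEOrderEmb hk), fun h e => ?_⟩
  rw [hp e]
  refine ((hp (Fin.castLEOrderEmb hk)).1 h).trans (Finset.sum_le_sum fun i _ => hd ?_)
  exact e.castLE_le_apply hk i

/-! ### Determinantal divisors -/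

theorem detDivisor_dvd_minor {F : Type*} [Field F] {m n k : ℕ} (G : Matrix (Fin m) (Fin n) F[X])
    (e₁ : Fin k ↪o Fin m) (e₂ : Fin k ↪o Fin n) : detDivisor G k ∣ (G.submatrix e₁ e₂).det := by
  let := Classical.decEq F
  let : NormalizedGCDMonoid F[X] := UniqueFactorizationMonoid.toNormalizedGCDMonoid F[X]
  exact Finset.gcd_dvd (f := fun e : (Fin k ↪o Fin m) × (Fin k ↪o Fin n) =>
    (G.submatrix e.1 e.2).det) (Finset.mem_univ (e₁, e₂))

theorem dvd_detDivisor {F : Type*} [Field F] {m n k : ℕ} {G : Matrix (Fin m) (Fin n) F[X]}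
    {q : F[X]} (h : ∀ (e₁ : Fin k ↪o Fin m) (e₂ : Fin k ↪o Fin n), q ∣ (G.submatrix e₁ e₂).det) :
    q ∣ detDivisor G k := by
  let := Classical.decEq F
  let : NormalizedGCDMonoid F[X] := UniqueFactorizationMonoid.toNormalizedGCDMonoid F[X]
  exact Finset.dvd_gcd fun e _ => h e.1 e.2

/-- This lets the gcd be taken over `F` and tested over a larger ring: the preimage of the ideal
`(q)` is principal, so `q ∣ φ x` amounts to `g ∣ x` for a single `g` in `F[X]`. -/
theorem dvd_map_detDivisor_iff {F S : Type*} [Field F] [CommRing S] (φ : F[X] →+* S) {m n k : ℕ}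
    {G : Matrix (Fin m) (Fin n) F[X]} {q : S} :
    q ∣ φ (detDivisor G k) ↔ DvdMinors q k (G.map φ) := by
  have hdet : ∀ (e₁ : Fin k ↪o Fin m) (e₂ : Fin k ↪o Fin n),
      ((G.map φ).submatrix e₁ e₂).det = φ (G.submatrix e₁ e₂).det := fun e₁ e₂ => by
    rw [φ.map_det]
    rfl
  rw [dvdMinors_iff_orderEmbedding]
  constructor
  · intro h e₁ e₂
    rw [hdet]
    exact h.trans (map_dvd φ (detDivisor_dvd_minor G e₁ e₂))
  · intro h
    obtain ⟨g, hg⟩ := (IsPrincipalIdealRing.principal ((Ideal.span {q}).comap φ)).principal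
    have hmem : ∀ x, q ∣ φ x ↔ g ∣ x := fun x => by
      rw [← Ideal.mem_span_singleton, ← Ideal.mem_comap, hg, ← Ideal.mem_span_singleton]
    rw [hmem]
    refine dvd_detDivisor fun e₁ e₂ => ?_
    rw [← hmem, ← hdet]
    exact h e₁ e₂

theorem detDivisor_dvd_succ {F : Type*} [Field F] {m n : ℕ} (G : Matrix (Fin m) (Fin n) F[X])
    (k : ℕ) : detDivisor G k ∣ detDivisor G (k + 1) := by
  refine dvd_detDivisor fun e₁ e₂ => ?_
  rw [Matrix.det_succ_row_zero]
  refine Finset.dvd_sum fun j _ => Dvd.dvd.mul_left ?_ _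
  exact detDivisor_dvd_minor G ((Fin.succOrderEmb k).trans e₁) ((Fin.succAboveOrderEmb j).trans e₂)

/-! ### Diagonal form and invariant factors -/

/-- A nonsingular matrix over `K[X]` is equivalent to a diagonal one, whose entries are ordered by
their order of vanishing at `μ`. -/
theorem exists_diagonal_monotone {K : Type*} [Field K] {n : ℕ} (G : Matrix (Fin n) (Fin n) K[X])
    (hG : G.det ≠ 0) (v : K[X] → ℕ) :
    ∃ (U V : Matrix (Fin n) (Fin n) K[X]) (d : Fin n → K[X]), IsUnit U.det ∧ IsUnit V.det ∧
      U * G * V = Matrix.diagonal d ∧ (Monotone fun i => v (d i)) ∧ ∀ i, d i ≠ 0 := by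
  have hinj : Function.Injective G.mulVecLin := by
    rw [← LinearMap.ker_eq_bot, LinearMap.ker_eq_bot']
    intro x hx
    exact Matrix.eq_zero_of_mulVec_eq_zero hG hx
  obtain ⟨b₀, a₀, c₀, h₀⟩ := Submodule.exists_smith_normal_form_of_rank_eq
    (N := LinearMap.range G.mulVecLin) (Pi.basisFun K[X] (Fin n))
    (LinearMap.finrank_range_of_inj hinj)
  -- The normal form used here carries no divisibility chain. Sorting by `v` replaces it, since only
  -- one point matters.
  set σ := Tuple.sort (v ∘ a₀)
  let b := b₀.reindex σ.symm
  let c := c₀.reindex σ.symm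
  let d := a₀ ∘ σ
  have hbc : ∀ i, (c i : Fin n → K[X]) = d i • b i := fun i => by simp [b, c, d, h₀]
  choose x hx using fun i => LinearMap.mem_range.1 (c i).2
  let V : Matrix (Fin n) (Fin n) K[X] := Matrix.of fun i j => x j i
  let T : Matrix (Fin n) (Fin n) K[X] := Matrix.of fun i j => b j i
  have hT : T = (Pi.basisFun K[X] (Fin n)).toMatrix b := by
    ext i j
    simp [T, Module.Basis.toMatrix_apply]
  have hTu : IsUnit T.det := by
    rw [hT, ← Module.Basis.det_apply]
    exact Module.Basis.isUnit_det _ b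
  have hGV : G * V = T * Matrix.diagonal d := by
    refine Matrix.ext fun i j => ?_
    have h1 := congrFun ((hx j).trans (hbc j)) i
    rw [Matrix.mul_diagonal]
    simpa [V, T, Matrix.mul_apply, Matrix.mulVec, dotProduct, mul_comm] using h1
  -- The columns of `G` are combinations of the basis `c` of its range; cancelling the injective `G`
  -- turns the coefficients into a right inverse of `V`.
  have hVu : IsUnit V.det := by
    choose y hy using fun j =>
      (Module.Basis.mem_submodule_iff' c (x := G.mulVecLin (Pi.single j 1))).1 (LinearMap.mem_range_self _ _)
    have hVy : V * (Matrix.of fun i j => y j i) = 1 := by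
      refine Matrix.ext fun i j => ?_
      have h1 : G.mulVecLin (∑ l, y j l • x l) = G.mulVecLin (Pi.single j 1) := by
        rw [hy j, map_sum]
        simp only [map_smul, hx]
      have h2 := congrFun (hinj h1) i
      simpa [V, Matrix.mul_apply, Matrix.one_apply, Pi.single_apply, mul_comm] using h2
    exact Matrix.isUnit_det_of_right_inverse hVy
  refine ⟨T⁻¹, V, d, Matrix.isUnit_nonsing_inv_det _ hTu, hVu, ?_, ?_, fun i hi => ?_⟩
  · rw [Matrix.mul_assoc, hGV, Matrix.nonsing_inv_mul_cancel_left _ _ hTu]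
  · exact Tuple.monotone_sort (v ∘ a₀)
  · refine c.ne_zero i (Subtype.ext ?_)
    rw [hbc, hi, zero_smul]
    rfl

theorem rootMultiplicity_finset_prod {K ι : Type*} [Field K] (s : Finset ι) (f : ι → K[X])
    (hf : ∀ i ∈ s, f i ≠ 0) (μ : K) :
    (∏ i ∈ s, f i).rootMultiplicity μ = ∑ i ∈ s, (f i).rootMultiplicity μ := by
  classical
  induction s using Finset.induction_on with
  | empty => simp
  | insert a s ha ih =>
    have h1 : ∀ i ∈ s, f i ≠ 0 := fun i hi => hf i (Finset.mem_insert_of_mem hi)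
    rw [Finset.prod_insert ha, Finset.sum_insert ha, rootMultiplicity_mul, ih h1]
    exact mul_ne_zero (hf a (Finset.mem_insert_self _ _)) (Finset.prod_ne_zero_iff.2 h1)

theorem rootMultiplicity_eq_of_forall_pow_dvd_iff {K : Type*} [Field K] {p q : K[X]} {μ : K}
    (hq : q ≠ 0) (h : ∀ a, (X - C μ) ^ a ∣ p ↔ (X - C μ) ^ a ∣ q) :
    p ≠ 0 ∧ p.rootMultiplicity μ = q.rootMultiplicity μ := by
  have hp : p ≠ 0 := by
    rintro rfl
    have := (le_rootMultiplicity_iff hq).2 ((h (q.rootMultiplicity μ + 1)).1 (dvd_zero _))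
    omega
  refine ⟨hp, eq_of_forall_le_iff fun a => ?_⟩
  rw [le_rootMultiplicity_iff hp, le_rootMultiplicity_iff hq, h]

section

variable {F K : Type*} [Field F] [Field K] (φ : F[X] →+* K[X]) {n : ℕ}
  {G : Matrix (Fin n) (Fin n) F[X]} {U V : Matrix (Fin n) (Fin n) K[X]} {d : Fin n → K[X]} {μ : K}

theorem rootMultiplicity_detDivisor (hU : IsUnit U.det) (hV : IsUnit V.det)
    (h : U * G.map φ * V = Matrix.diagonal d) (hm : Monotone fun i => (d i).rootMultiplicity μ)
    (hd : ∀ i, d i ≠ 0) {k : ℕ} (hk : k ≤ n) :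
    φ (detDivisor G k) ≠ 0 ∧ (φ (detDivisor G k)).rootMultiplicity μ =
      ∑ i : Fin k, (d (Fin.castLE hk i)).rootMultiplicity μ := by
  rw [← rootMultiplicity_finset_prod _ _ fun i _ => hd _]
  refine rootMultiplicity_eq_of_forall_pow_dvd_iff (Finset.prod_ne_zero_iff.2 fun i _ => hd _) ?_
  intro a
  rw [dvd_map_detDivisor_iff, ← dvdMinors_mul_mul_iff hU hV, h,
    dvdMinors_diagonal_iff_of_chain hk (rootMultiplicity μ) _ hm]
  intro e
  rw [← rootMultiplicity_finset_prod _ _ fun i _ => hd _, le_rootMultiplicity_iff]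
  exact Finset.prod_ne_zero_iff.2 fun i _ => hd _

/-- The sums of orders for `D_{j+1}` and `D_j` differ by the single term `d j`; indices of `d` start
at `0`, those of invariant factors at `1`. -/
theorem rootMultiplicity_invFactor (hU : IsUnit U.det) (hV : IsUnit V.det)
    (h : U * G.map φ * V = Matrix.diagonal d) (hm : Monotone fun i => (d i).rootMultiplicity μ)
    (hd : ∀ i, d i ≠ 0) (j : Fin n) :
    (φ (invFactor G (j + 1))).rootMultiplicity μ = (d j).rootMultiplicity μ := by
  obtain ⟨h0, h1⟩ := rootMultiplicity_detDivisor φ hU hV h hm hd j.2.le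
  obtain ⟨h2, h3⟩ := rootMultiplicity_detDivisor φ hU hV h hm hd (show (j : ℕ) + 1 ≤ n from j.2)
  have e : detDivisor G (j + 1) = detDivisor G j * invFactor G (j + 1) := by
    rw [invFactor, Nat.add_sub_cancel]
    exact (EuclideanDomain.mul_div_cancel' (fun h => h0 (by rw [h, map_zero]))
      (detDivisor_dvd_succ G j)).symm
  rw [e, map_mul] at h2 h3
  rw [rootMultiplicity_mul h2, h1, Fin.sum_univ_castSucc] at h3
  exact Nat.add_left_cancel h3

theorem card_filter_le_rootMultiplicity_invFactor (hU : IsUnit U.det) (hV : IsUnit V.det)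
    (h : U * G.map φ * V = Matrix.diagonal d) (hm : Monotone fun i => (d i).rootMultiplicity μ)
    (hd : ∀ i, d i ≠ 0) (i : ℕ) :
    ((Finset.Icc 1 n).filter fun j => i ≤ (φ (invFactor G j)).rootMultiplicity μ).card =
      (Finset.univ.filter fun j => i ≤ (d j).rootMultiplicity μ).card := by
  symm
  refine Finset.card_bij (fun j _ => (j : ℕ) + 1) ?_ ?_ ?_
  · intro j hj
    rw [Finset.mem_filter] at hj ⊢
    rw [rootMultiplicity_invFactor φ hU hV h hm hd, Finset.mem_Icc]
    exact ⟨⟨by omega, by omega⟩, hj.2⟩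
  · intro a _ b _ hab
    exact Fin.ext (by omega)
  · intro b hb
    rw [Finset.mem_filter, Finset.mem_Icc] at hb
    obtain ⟨⟨h1, h2⟩, h3⟩ := hb
    obtain ⟨b, rfl⟩ := Nat.exists_eq_add_of_le' h1
    refine ⟨⟨b, by omega⟩, ?_, rfl⟩
    rw [Finset.mem_filter, ← rootMultiplicity_invFactor φ hU hV h hm hd]
    exact ⟨Finset.mem_univ _, h3⟩

end

/-! ### The root space and its behaviour under perturbation -/

/-- The values at `μ` of the polynomial vectors `x` such that `(X - μ) ^ i` divides `G x`. -/
noncomputable def rootSpace {K : Type*} [Field K] {n : ℕ} (G : Matrix (Fin n) (Fin n) K[X]) (μ : K)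
    (i : ℕ) : Submodule K (Fin n → K) where
  carrier := {y | ∃ x : Fin n → K[X], (∀ j, (X - C μ) ^ i ∣ (G.mulVec x) j) ∧
    ∀ j, (x j).eval μ = y j}
  zero_mem' := ⟨0, by simp, by simp⟩
  add_mem' := by
    rintro a b ⟨x, hx, hxa⟩ ⟨y, hy, hyb⟩
    refine ⟨x + y, fun j => ?_, fun j => ?_⟩
    · rw [Matrix.mulVec_add]
      exact dvd_add (hx j) (hy j)
    · simp [hxa, hyb]
  smul_mem' := by
    rintro c a ⟨x, hx, hxa⟩
    refine ⟨C c • x, fun j => ?_, fun j => ?_⟩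
    · rw [Matrix.mulVec_smul]
      exact (hx j).mul_left _
    · simp [hxa]

section

variable {K : Type*} [Field K] {n : ℕ} {G : Matrix (Fin n) (Fin n) K[X]} {μ : K} {i : ℕ}

/-- The substitution `x ↦ V⁻¹ x` acts on values at `μ` through the invertible matrix `V⁻¹(μ)`, while
multiplication by `U` preserves divisibility. -/
theorem finrank_rootSpace_le_mul_mul {U V : Matrix (Fin n) (Fin n) K[X]} (hV : IsUnit V.det) :
    Module.finrank K (rootSpace G μ i) ≤ Module.finrank K (rootSpace (U * G * V) μ i) := by
  have hinv : V.map (evalRingHom μ) * V⁻¹.map (evalRingHom μ) = 1 := by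
    rw [← Matrix.map_mul, Matrix.mul_nonsing_inv _ hV]
    exact Matrix.map_one _ (map_zero _) (map_one _)
  let f := (V⁻¹.map (evalRingHom μ)).mulVecLin
  have hf : Function.Injective f := by
    intro a b hab
    have := congrArg (V.map (evalRingHom μ)).mulVec hab
    simpa only [f, Matrix.mulVecLin_apply, Matrix.mulVec_mulVec, hinv, Matrix.one_mulVec] using this
  have hmap : (rootSpace G μ i).map f ≤ rootSpace (U * G * V) μ i := by
    rintro _ ⟨y, ⟨x, hx, hxy⟩, rfl⟩
    refine ⟨V⁻¹.mulVec x, fun j => ?_, fun j => ?_⟩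
    · rw [Matrix.mulVec_mulVec, Matrix.mul_nonsing_inv_cancel_right _ _ hV, ← Matrix.mulVec_mulVec,
        Matrix.mulVec, dotProduct]
      exact Finset.dvd_sum fun l _ => (hx l).mul_left _
    · simp [f, Matrix.mulVec, dotProduct, eval_finsetSum, hxy]
  exact (LinearEquiv.finrank_eq (Submodule.equivMapOfInjective f hf _)).trans_le
    (Submodule.finrank_mono hmap)

theorem finrank_rootSpace_mul_mul {U V : Matrix (Fin n) (Fin n) K[X]} (hU : IsUnit U.det)
    (hV : IsUnit V.det) :
    Module.finrank K (rootSpace (U * G * V) μ i) = Module.finrank K (rootSpace G μ i) := by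
  refine le_antisymm ?_ (finrank_rootSpace_le_mul_mul hV)
  have := finrank_rootSpace_le_mul_mul (G := U * G * V) (μ := μ) (i := i) (U := U⁻¹)
    (V := V⁻¹) (Matrix.isUnit_nonsing_inv_det _ hV)
  have e : U⁻¹ * (U * G * V) * V⁻¹ = G := by
    rw [Matrix.mul_assoc U, Matrix.nonsing_inv_mul_cancel_left _ _ hU,
      Matrix.mul_nonsing_inv_cancel_right _ _ hV]
  rwa [e] at this

/-- The root space is a coordinate subspace: if `x j` does not vanish at `μ`, all of `(X - μ) ^ i`
must divide `d j`; on the remaining coordinates constants are allowed. -/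
theorem finrank_rootSpace_diagonal {d : Fin n → K[X]} (hd : ∀ j, d j ≠ 0) :
    Module.finrank K (rootSpace (Matrix.diagonal d) μ i) =
      (Finset.univ.filter fun j => i ≤ (d j).rootMultiplicity μ).card := by
  classical
  have e : rootSpace (Matrix.diagonal d) μ i =
      ⨅ j ∈ {j | i ≤ (d j).rootMultiplicity μ}ᶜ, LinearMap.ker (LinearMap.proj j) := by
    ext y
    simp only [Submodule.mem_iInf, LinearMap.mem_ker, LinearMap.proj_apply, Set.mem_compl_iff,
      Set.mem_ofPred_eq]
    constructor
    · rintro ⟨x, hx, hxy⟩ j hj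
      rw [← hxy]
      by_contra h
      have hx0 : x j ≠ 0 := fun h0 => h (by rw [h0, eval_zero])
      have h1 := hx j
      rw [Matrix.mulVec_diagonal, ← le_rootMultiplicity_iff (mul_ne_zero (hd j) hx0),
        rootMultiplicity_mul (mul_ne_zero (hd j) hx0), rootMultiplicity_eq_zero h] at h1
      exact hj h1
    · intro h
      refine ⟨fun j => C (y j), fun j => ?_, fun j => eval_C⟩
      rw [Matrix.mulVec_diagonal]
      by_cases hj : i ≤ (d j).rootMultiplicity μ
      · exact ((le_rootMultiplicity_iff (hd j)).1 hj).mul_right _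
      · simp [h j hj]
  rw [e]
  let I : Set (Fin n) := {j | i ≤ (d j).rootMultiplicity μ}
  have := (LinearMap.iInfKerProjEquiv K (fun _ : Fin n => K) (I := I) (J := Iᶜ)
    disjoint_compl_right (by simp)).finrank_eq
  refine this.trans ?_
  rw [Module.finrank_fintype_fun_eq_card, Fintype.card_subtype]
  rfl

/-- Over the principal ideal domain `K[X]` the image `P L` is free of rank at most `rank P`.
Subtracting lifts `x k` of its basis moves any `z` in `L` into `ker P`, where `G + P` acts as `G`;
the values of the lifts at `μ` span the only possible loss. -/
theorem finrank_rootSpace_le_add (P : Matrix (Fin n) (Fin n) K[X]) :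
    Module.finrank K (rootSpace G μ i) ≤ Module.finrank K (rootSpace (G + P) μ i) + P.rank := by
  let L : Submodule K[X] (Fin n → K[X]) :=
    { carrier := {x | ∀ j, (X - C μ) ^ i ∣ (G.mulVec x) j}
      zero_mem' := by simp
      add_mem' := by
        intro a b ha hb j
        rw [Matrix.mulVec_add]
        exact dvd_add (ha j) (hb j)
      smul_mem' := by
        intro c a ha j
        rw [Matrix.mulVec_smul]
        exact (ha j).mul_left _ }
  have hle : L.map P.mulVecLin ≤ LinearMap.range P.mulVecLin := LinearMap.map_le_range
  let b := Module.finBasis K[X] (L.map P.mulVecLin)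
  have hs : Module.finrank K[X] (L.map P.mulVecLin) ≤ P.rank := Submodule.finrank_mono hle
  choose x hxL hx using fun k => (b k).2
  let y : Fin (Module.finrank K[X] (L.map P.mulVecLin)) → Fin n → K := fun k j => (x k j).eval μ
  have hsup : rootSpace G μ i ≤ rootSpace (G + P) μ i ⊔ Submodule.span K (Set.range y) := by
    rintro w ⟨z, hz, hzw⟩
    obtain ⟨c, hc⟩ := (Module.Basis.mem_submodule_iff' b).1
      (Submodule.mem_map_of_mem (show z ∈ L from hz))
    have hw : w = (w - ∑ k, (c k).eval μ • y k) + ∑ k, (c k).eval μ • y k := by abel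
    rw [hw]
    refine Submodule.add_mem_sup ⟨z - ∑ k, c k • x k, ?_, fun j => ?_⟩
      (Submodule.sum_mem _ fun k _ => Submodule.smul_mem _ _ (Submodule.subset_span ⟨k, rfl⟩))
    · have h0 : P.mulVecLin (z - ∑ k, c k • x k) = 0 := by
        rw [map_sub, map_sum, hc, sub_eq_zero]
        exact Finset.sum_congr rfl fun k _ => by rw [map_smul, hx]
      rw [Matrix.add_mulVec, show P.mulVec (z - ∑ k, c k • x k) = 0 from h0, add_zero]
      exact L.sub_mem hz (L.sum_mem fun k _ => L.smul_mem _ (hxL k))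
    · simp [y, hzw, eval_finsetSum, Finset.sum_apply]
  calc Module.finrank K (rootSpace G μ i)
      ≤ Module.finrank K ↥(rootSpace (G + P) μ i ⊔ Submodule.span K (Set.range y)) :=
        Submodule.finrank_mono hsup
    _ ≤ Module.finrank K (rootSpace (G + P) μ i) +
        Module.finrank K (Submodule.span K (Set.range y)) := Submodule.finrank_add_le_finrank_add_finrank _ _
    _ ≤ _ := by
        gcongr
        refine (finrank_range_le_card y).trans ?_
        rwa [Fintype.card_fin]

end

/-- The number of invariant factors divisible by `(X - μ) ^ i`, as the dimension of a space. -/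
theorem card_filter_le_rootMultiplicity_eq_finrank {F K : Type*} [Field F] [Field K]
    (φ : F[X] →+* K[X]) {n : ℕ} (G : Matrix (Fin n) (Fin n) F[X]) (hG : (G.map φ).det ≠ 0) (μ : K)
    (i : ℕ) :
    ((Finset.Icc 1 n).filter fun j => i ≤ (φ (invFactor G j)).rootMultiplicity μ).card =
      Module.finrank K (rootSpace (G.map φ) μ i) := by
  obtain ⟨U, V, d, hU, hV, h, hm, hd⟩ := exists_diagonal_monotone (G.map φ) hG (rootMultiplicity μ)
  rw [card_filter_le_rootMultiplicity_invFactor φ hU hV h hm hd, ← finrank_rootSpace_diagonal hd,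
    ← h, finrank_rootSpace_mul_mul hU hV]

/-! ### Comparison of ranks over different rings -/

/-- A factorization of `M` through `M.rank` columns survives any ring homomorphism. -/
theorem Matrix.rank_map_le {k L m n : Type*} [Field k] [Field L] [Fintype m] [Fintype n]
    (f : k →+* L) (M : Matrix m n k) : (M.map f).rank ≤ M.rank := by
  classical
  let b := Module.finBasis k (LinearMap.range M.mulVecLin)
  let B : Matrix m (Fin M.rank) k := Matrix.of fun i j => (b j : m → k) i
  let D : Matrix (Fin M.rank) n k := Matrix.of fun i j =>
    b.repr ⟨M.mulVecLin (Pi.single j 1), LinearMap.mem_range_self _ _⟩ i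
  have h : M = B * D := by
    refine Matrix.ext fun i j => ?_
    have h1 := congrArg (fun x : LinearMap.range M.mulVecLin => (x : m → k) i)
      (b.sum_repr ⟨M.mulVecLin (Pi.single j 1), LinearMap.mem_range_self _ _⟩)
    simp only [Submodule.coe_sum, Finset.sum_apply, Submodule.coe_smul, Pi.smul_apply,
      smul_eq_mul] at h1
    have h2 : M.mulVecLin (Pi.single j 1) i = M i j := by simp
    rw [Matrix.mul_apply, ← h2, ← h1]
    exact Finset.sum_congr rfl fun k _ => mul_comm _ _
  calc (M.map f).rank = (B.map f * D.map f).rank := by rw [← Matrix.map_mul, ← h]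
    _ ≤ (B.map f).rank := Matrix.rank_mul_le_left _ _
    _ ≤ M.rank := (Matrix.rank_le_card_width _).trans_eq (Fintype.card_fin _)

/-- A basis of the column module stays independent over the fraction field, by clearing denominators
in a relation. -/
theorem Matrix.rank_le_rank_map_algebraMap {R Q m n : Type*} [CommRing R] [IsDomain R]
    [IsPrincipalIdealRing R] [Field Q] [Algebra R Q] [IsFractionRing R Q] [Fintype m] [Fintype n]
    (M : Matrix m n R) : M.rank ≤ (M.map (algebraMap R Q)).rank := by
  let b := Module.finBasis R (LinearMap.range M.mulVecLin)
  choose x hx using fun j => LinearMap.mem_range.1 (b j).2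
  let B : Matrix m (Fin M.rank) R := Matrix.of fun i j => (b j : m → R) i
  let Y : Matrix n (Fin M.rank) R := Matrix.of fun i j => x j i
  have h : B = M * Y := Matrix.ext fun i j => (congrFun (hx j) i).symm
  have hB : ∀ w, B.mulVec w = 0 → w = 0 := by
    intro w hw
    have h1 : ∑ j, w j • b j = 0 := by
      refine Subtype.ext (funext fun i => ?_)
      have := congrFun hw i
      simpa [B, Matrix.mulVec, dotProduct, Finset.sum_apply, mul_comm] using this
    exact funext (Fintype.linearIndependent_iff.1 b.linearIndependent w h1)
  have hinj : Function.Injective (B.map (algebraMap R Q)).mulVecLin := by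
    rw [← LinearMap.ker_eq_bot, LinearMap.ker_eq_bot']
    intro z hz
    obtain ⟨s, hs⟩ := IsLocalization.exist_integer_multiples_of_finite (nonZeroDivisors R) z
    choose w hw using hs
    have hw0 : w = 0 := by
      refine hB w (funext fun i => IsFractionRing.injective R Q ?_)
      have h1 := congrArg (fun t => algebraMap R Q s * t) (congrFun hz i)
      simp only [Matrix.mulVecLin_apply, Matrix.mulVec, dotProduct, Matrix.map_apply,
        Finset.mul_sum, Pi.zero_apply, mul_zero] at h1
      simp only [Matrix.mulVec, dotProduct, map_sum, map_mul, hw, Algebra.smul_def, Pi.zero_apply,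
        map_zero]
      rw [← h1]
      exact Finset.sum_congr rfl fun j _ => by ring
    funext j
    have h1 := hw j
    rw [hw0, Pi.zero_apply, map_zero, Algebra.smul_def, eq_comm, mul_eq_zero] at h1
    exact h1.resolve_left (IsLocalization.map_units Q s).ne_zero
  calc M.rank = (B.map (algebraMap R Q)).rank := by
        have := LinearMap.finrank_range_of_inj hinj
        rw [Module.finrank_fintype_fun_eq_card, Fintype.card_fin] at this
        exact this.symm
    _ = (M.map (algebraMap R Q) * Y.map (algebraMap R Q)).rank := by rw [← Matrix.map_mul, ← h]
    _ ≤ _ := Matrix.rank_mul_le_left _ _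

theorem rank_map_polynomial_le_normalRank {F K : Type*} [Field F] [Field K] [Algebra F K] {n : ℕ}
    (P : Matrix (Fin n) (Fin n) F[X]) :
    (P.map (mapRingHom (algebraMap F K))).rank ≤ normalRank P := by
  refine (Matrix.rank_le_rank_map_algebraMap (Q := RatFunc K) _).trans ?_
  let g : F[X] →+* RatFunc K := (algebraMap K[X] (RatFunc K)).comp (mapRingHom (algebraMap F K))
  have hg : Function.Injective g := (IsFractionRing.injective K[X] (RatFunc K)).comp
    (map_injective _ (algebraMap F K).injective)
  -- Passing through the field embedding of `F(X)` into `K(X)` brings in the normal rank over `F`.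
  have e : (P.map (mapRingHom (algebraMap F K))).map (algebraMap K[X] (RatFunc K)) =
      (P.map (algebraMap F[X] (RatFunc F))).map (IsFractionRing.lift hg) := by
    refine Matrix.ext fun i j => ?_
    simp only [Matrix.map_apply]
    rw [IsFractionRing.lift_algebraMap]
    rfl
  rw [e]
  exact Matrix.rank_map_le _ _

/-! ### The reversed pencil -/

theorem map_revPencil_eq {F : Type*} [Field F] {n : ℕ} {P : Matrix (Fin n) (Fin n) F[X]}
    (hP : IsPencil P) (i j : Fin n) : algebraMap F[X] (RatFunc F) (revPencil P i j) =
      RatFunc.X * aeval (RatFunc.X⁻¹ : RatFunc F) (P i j) := by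
  conv_rhs => rw [eq_X_add_C_of_degree_le_one (hP i j)]
  have hX : (RatFunc.X : RatFunc F) ≠ 0 := RatFunc.X_ne_zero
  simp only [revPencil, Matrix.of_apply, map_add, map_mul, aeval_C, aeval_X,
    RatFunc.algebraMap_X, RatFunc.algebraMap_C, RatFunc.algebraMap_eq_C]
  field_simp
  ring

/-- If `p(1/X) = 0`, then the reversal of `p` vanishes at `X`, so it is zero and so is `p`. -/
theorem aeval_X_inv_injective {F : Type*} [Field F] :
    Function.Injective (aeval (RatFunc.X⁻¹ : RatFunc F) : F[X] →ₐ[F] RatFunc F) := by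
  rw [injective_iff_map_eq_zero]
  intro p hp
  let : Invertible (RatFunc.X⁻¹ : RatFunc F) := invertibleOfNonzero (inv_ne_zero RatFunc.X_ne_zero)
  have h := (eval₂_reverse_eq_zero_iff (algebraMap F (RatFunc F)) RatFunc.X⁻¹ p).2 hp
  rw [invOf_eq_inv, inv_inv, ← aeval_def, RatFunc.aeval_X_left_eq_algebraMap,
    map_eq_zero_iff _ (IsFractionRing.injective F[X] (RatFunc F)), reverse_eq_zero] at h
  exact h

theorem rank_revPencil_le_normalRank {F : Type*} [Field F] {n : ℕ}
    {P : Matrix (Fin n) (Fin n) F[X]} (hP : IsPencil P) : (revPencil P).rank ≤ normalRank P := by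
  refine (Matrix.rank_le_rank_map_algebraMap (Q := RatFunc F) _).trans ?_
  let g : F[X] →+* RatFunc F := (aeval (RatFunc.X⁻¹ : RatFunc F) : F[X] →ₐ[F] RatFunc F).toRingHom
  have hg : Function.Injective g := aeval_X_inv_injective
  -- `t P₀ + P₁ = t P(1/t)`: apply the field endomorphism `X ↦ 1/X`, then scale.
  have e : (revPencil P).map (algebraMap F[X] (RatFunc F)) =
      Matrix.diagonal (fun _ => RatFunc.X) *
        (P.map (algebraMap F[X] (RatFunc F))).map (IsFractionRing.lift hg) := by
    refine Matrix.ext fun i j => ?_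
    rw [Matrix.diagonal_mul]
    simp only [Matrix.map_apply]
    rw [IsFractionRing.lift_algebraMap, map_revPencil_eq hP]
    rfl
  rw [e]
  exact (Matrix.rank_mul_le_right _ _).trans (Matrix.rank_map_le _ _)

theorem det_revPencil_ne_zero {F : Type*} [Field F] {n : ℕ} {G : Matrix (Fin n) (Fin n) F[X]}
    (hG : IsRegularPencil G) : (revPencil G).det ≠ 0 := by
  intro h
  have e : (revPencil G).map (algebraMap F[X] (RatFunc F)) =
      (RatFunc.X : RatFunc F) • G.map (aeval (RatFunc.X⁻¹ : RatFunc F)) :=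
    Matrix.ext fun i j => map_revPencil_eq hG.1 i j
  have h1 := congrArg (algebraMap F[X] (RatFunc F)) h
  rw [RingHom.map_det, RingHom.mapMatrix_apply, e, Matrix.det_smul, map_zero, mul_eq_zero] at h1
  have h2 := h1.resolve_left (pow_ne_zero _ RatFunc.X_ne_zero)
  refine hG.2 (aeval_X_inv_injective ?_)
  rw [map_zero, AlgHom.map_det]
  exact h2

/-- Reversal is linear in the coefficients and commutes with constant factors, so the same `Q` and
`R` serve at `∞`. -/
theorem revPencil_mul_mul_add {F : Type*} [Field F] {n : ℕ} {A P B : Matrix (Fin n) (Fin n) F[X]}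
    {Q R : Matrix (Fin n) (Fin n) F} (h : A + P = Q.map C * B * R.map C) :
    revPencil A + revPencil P = Q.map C * revPencil B * R.map C := by
  have key : ∀ (k : ℕ) i j, (A i j).coeff k + (P i j).coeff k =
      ∑ l, (∑ m, Q i m * (B m l).coeff k) * R l j := by
    intro k i j
    have := congrArg (fun M => (M i j).coeff k) h
    simpa [Matrix.mul_apply, Matrix.add_apply, finsetSum_coeff] using this
  have e : ∀ i j, revPencil A i j + revPencil P i j =
      X * C (∑ l, (∑ m, Q i m * (B m l).coeff 0) * R l j) +
        C (∑ l, (∑ m, Q i m * (B m l).coeff 1) * R l j) := by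
    intro i j
    rw [← key, ← key]
    simp only [revPencil, Matrix.of_apply, map_add]
    ring
  refine Matrix.ext fun i j => ?_
  rw [Matrix.add_apply, e]
  simp only [revPencil, Matrix.mul_apply, Matrix.of_apply, Matrix.map_apply, map_sum, map_mul,
    Finset.sum_mul, Finset.mul_sum, ← Finset.sum_add_distrib]
  refine Finset.sum_congr rfl fun l _ => Finset.sum_congr rfl fun m _ => ?_
  ring

theorem isUnit_det_map_C {F K : Type*} [Field F] [Field K] (φ : F[X] →+* K[X]) {n : ℕ}
    (Q : GL (Fin n) F) : IsUnit (((Q : Matrix (Fin n) (Fin n) F).map C).map φ).det := by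
  have h : IsUnit (Q : Matrix (Fin n) (Fin n) F).det :=
    (Matrix.isUnit_iff_isUnit_det _).1 Q.isUnit
  have := h.map (φ.comp C)
  rw [RingHom.map_det] at this
  exact this

/-! ### The perturbation bound at finite points and at infinity -/

/-- The number of invariant factors divisible by `(X - μ) ^ i` changes by at most `rank P` under
the perturbation `P`. -/
theorem abs_card_filter_sub_le {F K : Type*} [Field F] [Field K] (φ : F[X] →+* K[X]) {n r : ℕ}
    {A B P : Matrix (Fin n) (Fin n) F[X]} {Q R : GL (Fin n) F}
    (hA : (A.map φ).det ≠ 0) (hB : (B.map φ).det ≠ 0) (hP : (P.map φ).rank ≤ r)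
    (h : A + P = (Q : Matrix (Fin n) (Fin n) F).map C * B * (R : Matrix (Fin n) (Fin n) F).map C)
    (μ : K) (i : ℕ) :
    |(((Finset.Icc 1 n).filter fun j => i ≤ (φ (invFactor A j)).rootMultiplicity μ).card : ℤ) -
      ((Finset.Icc 1 n).filter fun j => i ≤ (φ (invFactor B j)).rootMultiplicity μ).card| ≤ r := by
  rw [card_filter_le_rootMultiplicity_eq_finrank φ A hA,
    card_filter_le_rootMultiplicity_eq_finrank φ B hB]
  have h' : A.map φ + P.map φ = ((Q : Matrix (Fin n) (Fin n) F).map C).map φ * B.map φ *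
      ((R : Matrix (Fin n) (Fin n) F).map C).map φ := by
    rw [← Matrix.map_add φ (map_add φ), h, Matrix.map_mul, Matrix.map_mul]
  have e := finrank_rootSpace_mul_mul (G := B.map φ) (μ := μ) (i := i) (isUnit_det_map_C φ Q)
    (isUnit_det_map_C φ R)
  rw [← h'] at e
  have h1 := finrank_rootSpace_le_add (G := A.map φ) (μ := μ) (i := i) (P.map φ)
  have h2 := finrank_rootSpace_le_add (G := A.map φ + P.map φ) (μ := μ) (i := i) (-P.map φ)
  have h3 : (-P.map φ).rank ≤ (P.map φ).rank := by
    have := Matrix.rank_mul_le_left (P.map φ) (-1 : Matrix (Fin n) (Fin n) K[X])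
    rwa [Matrix.mul_neg, Matrix.mul_one] at this
  rw [add_neg_cancel_right] at h2
  rw [abs_le]
  omega

theorem abs_conjMult_sub_le {F : Type*} [Field F] {n r : ℕ} {A B P : Matrix (Fin n) (Fin n) F[X]}
    (hA : IsRegularPencil A) (hB : IsRegularPencil B) (hP : IsPencil P)
    (hr : normalRank P = r) (hAB : StrictlyEquivalent (A + P) B)
    (μ : OnePoint (AlgebraicClosure F)) (i : ℕ) :
    |(conjMult A μ i : ℤ) - conjMult B μ i| ≤ r := by
  obtain ⟨Q, R, h⟩ := hAB
  subst hr
  cases μ with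
  | infty =>
    refine abs_card_filter_sub_le (RingHom.id F[X]) (A := revPencil A) (B := revPencil B)
      (P := revPencil P) (Q := Q) (R := R) ?_ ?_ ?_ (revPencil_mul_mul_add h) 0 i
    · exact det_revPencil_ne_zero hA
    · exact det_revPencil_ne_zero hB
    · exact rank_revPencil_le_normalRank hP
  | coe μ =>
    have hinj : Function.Injective (mapRingHom (algebraMap F (AlgebraicClosure F))) :=
      map_injective _ (algebraMap F _).injective
    have hdet : ∀ G : Matrix (Fin n) (Fin n) F[X], G.det ≠ 0 →
        (G.map (mapRingHom (algebraMap F (AlgebraicClosure F)))).det ≠ 0 := fun G hG h0 => by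
      rw [← RingHom.mapMatrix_apply, ← RingHom.map_det, map_eq_zero_iff _ hinj] at h0
      exact hG h0
    exact abs_card_filter_sub_le (mapRingHom (algebraMap F (AlgebraicClosure F)))
      (hdet A hA.2) (hdet B hB.2) (rank_map_polynomial_le_normalRank P) h μ i

theorem corollary4p4 {F : Type*} [Field F] (n r : ℕ) (A B P : Matrix (Fin n) (Fin n) F[X])
    (hA : IsRegularPencil A) (hB : IsRegularPencil B) (hP : IsPencil P)
    (hr : normalRank P = r) (hAB : StrictlyEquivalent (A + P) B) :
    (∀ (μ : OnePoint (AlgebraicClosure F)) (i : ℕ), 1 ≤ i → i ≤ n →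
      (conjMult A μ i : ℤ) - r ≤ conjMult B μ i ∧
      (conjMult B μ i : ℤ) ≤ conjMult A μ i + r) ∧
    (∀ (μ : OnePoint (AlgebraicClosure F)) (i : ℕ), 1 ≤ i → i ≤ n →
      (conjMult B μ i : ℤ) - r ≤ conjMult A μ i ∧
      (conjMult A μ i : ℤ) ≤ conjMult B μ i + r) ∧
    (∀ μ : OnePoint (AlgebraicClosure F),
      (geomMult A μ : ℤ) - r ≤ geomMult B μ ∧
      (geomMult B μ : ℤ) ≤ geomMult A μ + r) := by
  have key := fun μ i => abs_le.1 (abs_conjMult_sub_le hA hB hP hr hAB μ i)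
  refine ⟨fun μ i _ _ => ?_, fun μ i _ _ => ?_, fun μ => ?_⟩
  · have := key μ i
    omega
  · have := key μ i
    omega
  -- `0 < m` unfolds to `1 ≤ m`, so `geomMult` is `conjMult` at `i = 1` by definition.
  · have : -(r : ℤ) ≤ geomMult A μ - geomMult B μ ∧ (geomMult A μ : ℤ) - geomMult B μ ≤ r :=
      key μ 1
    omega
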